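/- \textbf{Theorem (Minimum degree).} The edges of the complete graph on $n$ labelled vertices are presented one at a time, in uniformly random order; $G_t$ is the graph of the first $t$ edges presented (all edges, if $t\ge\binom n2$). Builder must decide immediately and irrevocably whether to purchase each presented edge; $B_t\subseteq G_t$ is the graph on the same vertex set formed by the edges purchased by time $t$. A \emph{$(t,b)$-strategy} is a (potentially random) function that, for each $s\le t$, decides whether to purchase the edge presented at time $s$, given that edge and $B_{s-1}$, under the limitation that $B_s$ always has at most $b$ edges; its randomness is independent of the order of the edges. Let $\delta$ denote minimum degree. Let $k$ be a positive integer and let $\varepsilon>0$. \begin{enumerate} \item Let $t=t(n)$ and $b=b(n)$ be non-negative integers such that $t\ge(1+\varepsilon)n\log n/2$ and $b\ge(1+\varepsilon)kn/2$ for all sufficiently large $n$. Then there exists a $(t,b)$-strategy $B$ of Builder (one for each $n$) such that \[\lim_{n\to\infty}\Pr(\delta(B_t)\ge k)=1.\] \item (Optimality of the budget.) For all non-negative integers $n,t,b$ with $b<kn/2$, every $(t,b)$-strategy on $n$ vertices satisfies $\Pr(\delta(B_t)\ge k)=0$. \item (Optimality of the time.) If $t=t(n)$ is a non-negative integer with $t\le(1-\varepsilon)n\log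 n/2$ for all sufficiently large $n$, then $\lim_{n\to\infty}\Pr(G_t\text{ has an isolated vertex})=1$. \end{enumerate} -/

import Mathlib

open Filter Topology

/-- The edges of the complete graph on the vertex set `Fin n`. -/
abbrev Edge (n : ℕ) : Type := {e : Sym2 (Fin n) // ¬ e.IsDiag}

/-- An order in which all edges of the complete graph on `Fin n` are presented (from time `1` on:
the edge with index `i` is presented at time `i + 1`). -/
abbrev EdgeOrder (n : ℕ) : Type := Fin (Fintype.card (Edge n)) ≃ Edge n

instance instNonemptyEdgeOrder (n : ℕ) : Nonempty (EdgeOrder n) :=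
  ⟨(Fintype.equivFin (Edge n)).symm⟩

/-- The set of edges presented by time `t` when the edges arrive in the order `π`.
Once all edges have been presented, nothing happens any more. -/
def observedEdges {n : ℕ} (π : EdgeOrder n) (t : ℕ) : Set (Sym2 (Fin n)) :=
  {e | ∃ i : Fin (Fintype.card (Edge n)), i.val < t ∧ e = (π i).val}

/-- The law of `G_t`, the random graph process on `Fin n` at time `t`: the edges are presented in a
uniformly random order. -/
noncomputable def processLaw (n t : ℕ) : PMF (SimpleGraph (Fin n)) :=
  (PMF.uniformOfFintype (EdgeOrder n)).map
    (fun π => SimpleGraph.fromEdgeSet (observedEdges π t))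

/-- A decision rule of Builder: given the time `s`, the set of edges of his graph `B_{s-1}`, and
the edge presented at time `s`, it says whether that edge is purchased. -/
abbrev DecisionRule (n : ℕ) : Type :=
  ℕ → Finset (Sym2 (Fin n)) → Sym2 (Fin n) → Bool

/-- The edges purchased by time `s` by a Builder who follows the rule `σ`, when the edges arrive in
the order `π`. -/
def purchased {n : ℕ} (σ : DecisionRule n) (π : EdgeOrder n) : ℕ → Finset (Sym2 (Fin n))
  | 0 => ∅
  | s + 1 =>
    if h : s < Fintype.card (Edge n) then
      if σ (s + 1) (purchased σ π s) (π ⟨s, h⟩).val = true then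
        insert (π ⟨s, h⟩).val (purchased σ π s)
      else purchased σ π s
    else purchased σ π s

/-- A deterministic `(t,b)`-strategy: a decision rule under which Builder never has more than `b`
edges up to time `t`, in whatever order the edges arrive. -/
structure DetStrategy (n t b : ℕ) : Type where
  rule : DecisionRule n
  budget : ∀ (π : EdgeOrder n) (s : ℕ), s ≤ t → (purchased rule π s).card ≤ b

/-- A (potentially random) `(t,b)`-strategy: a random choice of a deterministic one, made
independently of the order of the edges. Only the finitely many decisions at times `s ≤ t` matter,
so discrete distributions cover all randomized strategies. -/
abbrev Strategy (n t b : ℕ) : Type := PMF (DetStrategy n t b)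

/-- The law of Builder's graph `B_t` under the strategy `S`, when the edges arrive in a uniformly
random order. -/
noncomputable def builderLaw {n t b : ℕ} (S : Strategy n t b) : PMF (SimpleGraph (Fin n)) :=
  S.bind fun σ => (PMF.uniformOfFintype (EdgeOrder n)).map
    (fun π => SimpleGraph.fromEdgeSet (purchased σ.rule π t : Set (Sym2 (Fin n))))

/-- The probability of the event `A` under the law `P` of a random graph. -/
noncomputable def graphProb {n : ℕ} (P : PMF (SimpleGraph (Fin n)))
    (A : Set (SimpleGraph (Fin n))) : ENNReal :=
  P.toOuterMeasure A

open Classical in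
/-- The minimum degree `δ(G)`. -/
noncomputable def minDeg {n : ℕ} (G : SimpleGraph (Fin n)) : ℕ := G.minDegree

/-! Time: Builder plays in two phases. In a short first phase of order `n log n` he buys an edge
only if both endpoints still have degree below `k`. All degrees then stay at most `k`, so at most
`kn/2` edges are bought. If `U` is the set of vertices still deficient at the end, every edge
presented inside `U` was bought, hence `U` spans at most `kn/2` presented edges. A union bound over
the at most `2 ^ n` vertex sets shows that with high probability no set of more than `εn/2` vertices
is this sparse, because each such set holds a positive fraction of all edges and `n log n` is
superlinear (`card_deficient_le`).

In the second phase he buys every edge with a deficient endpoint. Each purchase lowers the total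
deficiency by at least one, so at most `k · εn/2` more edges are bought and the budget never binds
(`potential_le`). A vertex still deficient at the end would have received all of its edges from this
phase. The phase is slightly longer than `n log n / 2`, so with high probability every vertex sees
more than `k` of them (`le_minDeg_twoPhase`). Both probability estimates come from one lower-tail
bound for sampling without replacement, `card_hits_le_le`.

Optimality of the budget is the handshake identity. Optimality of the time is the second moment
method for the number of isolated vertices: its mean is at least a positive power of `n`, and two
vertices are asymptotically uncorrelated (`prod_one_sub_two_mul_le`). -/

/-! ### Random bijections: sampling without replacement. -/

section Exchange

variable {α β : Type*} [Fintype α] [Fintype β] [DecidableEq α] [DecidableEq β]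

/-- A weight on bijections that depends only on the images of `J` sees the image of a further
position `a` as a uniformly random element outside the image of `J`. -/
theorem sum_exchange (J : Finset α) (a : α) (S : Finset β) (w : (α ≃ β) → ℝ)
    (hw : ∀ π : α ≃ β, ∀ i ∉ J, w ((Equiv.swap a i).trans π) = w π) :
    ((Fintype.card α : ℝ) - J.card) * ∑ π : α ≃ β, w π * (if π a ∈ S then 1 else 0) =
      ∑ π : α ≃ β, w π * ((S.card : ℝ) - (J.filter (fun i => π i ∈ S)).card) := by
  have hS : ∀ π : α ≃ β, ((S.card : ℝ) - (J.filter (fun i => π i ∈ S)).card) =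
      ∑ i ∈ Jᶜ, if π i ∈ S then (1 : ℝ) else 0 := by
    intro π
    have h1 : (S.card : ℝ) = ∑ i : α, if π i ∈ S then (1 : ℝ) else 0 := by
      rw [Finset.sum_boole]
      congr 1
      exact (Finset.card_bij (fun i _ => π i) (fun i hi => (Finset.mem_filter.1 hi).2)
        (fun i _ j _ h => π.injective h) (fun b hb => ⟨π.symm b, by simpa using hb, by simp⟩)).symm
    have h2 : ((J.filter (fun i => π i ∈ S)).card : ℝ) =
        ∑ i ∈ J, if π i ∈ S then (1 : ℝ) else 0 := by
      rw [Finset.sum_boole]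
    rw [h1, h2, ← Finset.sum_add_sum_compl J]
    ring
  have hcard : ((Fintype.card α : ℝ) - J.card) = (Jᶜ.card : ℝ) := by
    rw [Finset.card_compl, Nat.cast_sub (Finset.card_le_univ J)]
  simp_rw [hS, Finset.mul_sum]
  rw [Finset.sum_comm, hcard]
  -- Precomposing with the transposition of `a` and `i` is an involution that fixes the weight, so
  -- every position outside `J` contributes the same sum as `a`.
  have hi : ∀ i ∈ Jᶜ, (∑ π : α ≃ β, w π * if π i ∈ S then (1 : ℝ) else 0) =
      ∑ π : α ≃ β, w π * (if π a ∈ S then 1 else 0) := by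
    intro i hi
    rw [Finset.mem_compl] at hi
    let f : (α ≃ β) ≃ (α ≃ β) :=
      { toFun := fun π => (Equiv.swap a i).trans π
        invFun := fun π => (Equiv.swap a i).trans π
        left_inv := fun π => by ext; simp
        right_inv := fun π => by ext; simp }
    rw [← Equiv.sum_comp f]
    refine Finset.sum_congr rfl fun π _ => ?_
    have : f π = (Equiv.swap a i).trans π := rfl
    rw [this, hw π i hi]
    simp
  rw [Finset.sum_congr rfl hi, Finset.sum_const, nsmul_eq_mul, Finset.mul_sum]

/-- The positions in `J` that the bijection `π` sends into `S`. -/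
def hits (J : Finset α) (S : Finset β) (π : α ≃ β) : Finset α := J.filter (fun i => π i ∈ S)

theorem hits_swap (J : Finset α) (S : Finset β) (π : α ≃ β) {a i : α} (ha : a ∉ J) (hi : i ∉ J) :
    hits J S ((Equiv.swap a i).trans π) = hits J S π := by
  refine Finset.filter_congr fun l hl => ?_
  rw [Equiv.trans_apply, Equiv.swap_apply_of_ne_of_ne (ne_of_mem_of_not_mem hl ha)
    (ne_of_mem_of_not_mem hl hi)]

theorem card_hits_insert (J : Finset α) (S : Finset β) (π : α ≃ β) {a : α} (ha : a ∉ J) :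
    (hits (insert a J) S π).card = (hits J S π).card + if π a ∈ S then 1 else 0 := by
  unfold hits
  rw [Finset.filter_insert]
  split_ifs with h
  · rw [Finset.card_insert_of_notMem (by simp [ha])]
  · rfl

/-- An exponential moment of the hit count, cut off once the count exceeds `j`. The cutoff replaces
independence: while at most `j` elements of `S` are used, at least `|S| - j` remain, so each new
position hits `S` with conditional probability at least `(|S| - j) / N`, where `N` is the number of
positions, and costs a fixed factor. -/
theorem sum_truncated_pow_hits_le (S : Finset β) (j : ℕ) {x : ℝ} (hx0 : 0 ≤ x) (hx1 : x ≤ 1)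
    (hjS : j ≤ S.card) (hcard : Fintype.card α = Fintype.card β) (J : Finset α) :
    ∑ π : α ≃ β, (if (hits J S π).card ≤ j then x ^ (hits J S π).card else 0) ≤
      (1 - (1 - x) * ((S.card : ℝ) - j) / Fintype.card α) ^ J.card * Fintype.card (α ≃ β) := by
  induction J using Finset.induction_on with
  | empty => simp [hits]
  | insert a J ha ih =>
    set c : ℝ := 1 - (1 - x) * ((S.card : ℝ) - j) / Fintype.card α with hc
    set w : (α ≃ β) → ℝ := fun π => if (hits J S π).card ≤ j then x ^ (hits J S π).card else 0
      with hw
    have hw0 : ∀ π, 0 ≤ w π := fun π => by simp only [hw]; split_ifs <;> positivity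
    have hJ : J.card < Fintype.card α := Finset.card_lt_univ_of_notMem ha
    have hN : (0 : ℝ) < Fintype.card α := by exact_mod_cast (Nat.zero_le _).trans_lt hJ
    have hNJ : (0 : ℝ) < (Fintype.card α : ℝ) - J.card := by
      rw [sub_pos]; exact_mod_cast hJ
    have hjS' : (0 : ℝ) ≤ (S.card : ℝ) - j := by rw [sub_nonneg]; exact_mod_cast hjS
    have hSN : (S.card : ℝ) ≤ Fintype.card α := by
      rw [hcard]; exact_mod_cast Finset.card_le_univ S
    have hc0 : 0 ≤ c := by
      rw [hc, sub_nonneg, div_le_one hN]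
      have : (0:ℝ) ≤ j := Nat.cast_nonneg j
      nlinarith
    have hex := sum_exchange J a S w (fun π i hi => by simp only [hw]; rw [hits_swap J S π ha hi])
    have key : ((S.card : ℝ) - j) / Fintype.card α * ∑ π, w π ≤
        ∑ π : α ≃ β, w π * (if π a ∈ S then 1 else 0) := by
      have h1 : ((S.card : ℝ) - j) * ∑ π, w π ≤
          ∑ π : α ≃ β, w π * ((S.card : ℝ) - (J.filter (fun i => π i ∈ S)).card) := by
        rw [Finset.mul_sum]
        refine Finset.sum_le_sum fun π _ => ?_
        by_cases h : (hits J S π).card ≤ j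
        · rw [mul_comm]
          refine mul_le_mul_of_nonneg_left ?_ (hw0 π)
          have : ((hits J S π).card : ℝ) ≤ j := by exact_mod_cast h
          unfold hits at this
          linarith
        · simp [hw, h]
      rw [← hex] at h1
      rw [div_mul_eq_mul_div, div_le_iff₀ hN]
      refine h1.trans ?_
      rw [mul_comm]
      refine mul_le_mul_of_nonneg_left ?_ (Finset.sum_nonneg fun π _ => mul_nonneg (hw0 π) ?_)
      · linarith [(Nat.cast_nonneg J.card : (0:ℝ) ≤ _)]
      · split_ifs <;> norm_num
    calc ∑ π : α ≃ β, (if (hits (insert a J) S π).card ≤ j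
            then x ^ (hits (insert a J) S π).card else 0)
        ≤ ∑ π : α ≃ β, (w π - (1 - x) * (w π * (if π a ∈ S then 1 else 0))) := by
          refine Finset.sum_le_sum fun π _ => ?_
          rw [card_hits_insert J S π ha]
          by_cases h : π a ∈ S
          · simp only [h, if_true, hw]
            by_cases h1 : (hits J S π).card ≤ j
            · by_cases h2 : (hits J S π).card + 1 ≤ j
              · simp only [h1, h2, if_true]; rw [pow_succ]; linarith
              -- The count passes `j`: the weight drops to zero, which is even below `x` times its
              -- old value.
              · simp only [h1, h2, if_true, if_false]
                have := pow_nonneg hx0 (hits J S π).card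
                nlinarith
            · have h2 : ¬ (hits J S π).card + 1 ≤ j := by omega
              simp [h1, h2]
          · simp [h, hw]
      _ = ∑ π, w π - (1 - x) * ∑ π : α ≃ β, w π * (if π a ∈ S then 1 else 0) := by
          rw [Finset.sum_sub_distrib, ← Finset.mul_sum]
      _ ≤ ∑ π, w π - (1 - x) * (((S.card : ℝ) - j) / Fintype.card α * ∑ π, w π) := by
          have := mul_le_mul_of_nonneg_left key (sub_nonneg.2 hx1)
          linarith
      _ = c * ∑ π, w π := by rw [hc]; ring
      _ ≤ c * (c ^ J.card * Fintype.card (α ≃ β)) := mul_le_mul_of_nonneg_left ih hc0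
      _ = _ := by rw [Finset.card_insert_of_notMem ha, pow_succ]; ring

/-- Lower tail of the number of elements of `S` among the images of `J` under a random bijection. -/
theorem card_hits_le_le (S : Finset β) (j : ℕ) {x : ℝ} (hx0 : 0 < x) (hx1 : x ≤ 1)
    (hjS : j ≤ S.card) (hcard : Fintype.card α = Fintype.card β) (J : Finset α) :
    ((Finset.univ.filter fun π : α ≃ β => (hits J S π).card ≤ j).card : ℝ) ≤
      (x⁻¹) ^ j * Real.exp (-((1 - x) * ((S.card : ℝ) - j) / Fintype.card α * J.card)) *
        Fintype.card (α ≃ β) := by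
  have h1 := sum_truncated_pow_hits_le S j hx0.le hx1 hjS hcard J
  -- Markov's inequality: on the event the weight is at least `x ^ j`, as `x ≤ 1`.
  have h2 : x ^ j * ((Finset.univ.filter fun π : α ≃ β => (hits J S π).card ≤ j).card : ℝ) ≤
      ∑ π : α ≃ β, (if (hits J S π).card ≤ j then x ^ (hits J S π).card else 0) := by
    rw [← Finset.sum_filter, mul_comm, ← nsmul_eq_mul]
    refine Finset.card_nsmul_le_sum _ _ _ fun π hπ => ?_
    exact pow_le_pow_of_le_one hx0.le hx1 (Finset.mem_filter.1 hπ).2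
  set y := (1 - x) * ((S.card : ℝ) - j) / Fintype.card α with hy
  have hy1 : y ≤ 1 := by
    have hSN : (S.card : ℝ) ≤ Fintype.card α := by
      rw [hcard]; exact_mod_cast Finset.card_le_univ S
    have hjS' : (0 : ℝ) ≤ (S.card : ℝ) - j := by rw [sub_nonneg]; exact_mod_cast hjS
    refine div_le_one_of_le₀ ?_ (Nat.cast_nonneg _)
    have : (0:ℝ) ≤ j := Nat.cast_nonneg j
    nlinarith
  have h3 : (1 - y) ^ J.card ≤ Real.exp (-(y * J.card)) := by
    have : Real.exp (-(y * J.card)) = Real.exp (-y) ^ J.card := by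
      rw [← Real.exp_nat_mul]; ring_nf
    rw [this]
    exact pow_le_pow_left₀ (by linarith) (Real.one_sub_le_exp_neg y) _
  have hxj : 0 < x ^ j := pow_pos hx0 j
  rw [inv_pow, mul_assoc, ← div_eq_inv_mul, le_div_iff₀ hxj, mul_comm]
  exact (h2.trans h1).trans (mul_le_mul_of_nonneg_right h3 (Nat.cast_nonneg _))

/-- The number of bijections that keep `J` away from `S`. -/
theorem card_avoid_insert (S : Finset β) (J : Finset α) (a : α) (ha : a ∉ J) :
    ((Finset.univ.filter fun π : α ≃ β => ∀ i ∈ insert a J, π i ∉ S).card : ℝ) =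
      (1 - (S.card : ℝ) / ((Fintype.card α : ℝ) - J.card)) *
        (Finset.univ.filter fun π : α ≃ β => ∀ i ∈ J, π i ∉ S).card := by
  have hNJ : (0 : ℝ) < (Fintype.card α : ℝ) - J.card := by
    rw [sub_pos]; exact_mod_cast Finset.card_lt_univ_of_notMem ha
  set w : (α ≃ β) → ℝ := fun π => if ∀ i ∈ J, π i ∉ S then 1 else 0 with hw
  have hex := sum_exchange J a S w (fun π i hi => by
    simp only [hw]
    congr 1
    refine propext (forall₂_congr fun l hl => ?_)
    rw [Equiv.trans_apply, Equiv.swap_apply_of_ne_of_ne (ne_of_mem_of_not_mem hl ha)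
      (ne_of_mem_of_not_mem hl hi)])
  -- Where the weight is nonzero no element of `S` is used up, so the exchange identity gives the
  -- exact conditional probability.
  have h1 : ∑ π : α ≃ β, w π * ((S.card : ℝ) - (J.filter (fun i => π i ∈ S)).card) =
      S.card * ∑ π : α ≃ β, w π := by
    rw [Finset.mul_sum]
    refine Finset.sum_congr rfl fun π _ => ?_
    by_cases h : ∀ i ∈ J, π i ∉ S
    · have : J.filter (fun i => π i ∈ S) = ∅ := Finset.filter_eq_empty_iff.2 (fun i hi => h i hi)
      simp [hw, this, mul_comm]
    · simp only [hw, if_neg h]; ring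
  rw [h1] at hex
  have h2 : ((Finset.univ.filter fun π : α ≃ β => ∀ i ∈ J, π i ∉ S).card : ℝ) = ∑ π, w π := by
    rw [Finset.sum_boole]
  have h3 : ((Finset.univ.filter fun π : α ≃ β => ∀ i ∈ insert a J, π i ∉ S).card : ℝ) =
      ∑ π, w π - ∑ π, w π * (if π a ∈ S then 1 else 0) := by
    rw [← Finset.sum_sub_distrib, ← Finset.sum_boole]
    refine Finset.sum_congr rfl fun π _ => ?_
    by_cases h : π a ∈ S <;> simp [hw, h]
  rw [h3, h2]
  field_simp
  linarith

theorem card_avoid (S : Finset β) (J : Finset α) :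
    ((Finset.univ.filter fun π : α ≃ β => ∀ i ∈ J, π i ∉ S).card : ℝ) =
      (∏ i ∈ Finset.range J.card, (1 - (S.card : ℝ) / ((Fintype.card α : ℝ) - i))) *
        Fintype.card (α ≃ β) := by
  induction J using Finset.induction_on with
  | empty => simp
  | insert a J ha ih =>
    rw [card_avoid_insert S J a ha, ih, Finset.card_insert_of_notMem ha, Finset.prod_range_succ]
    ring

end Exchange

/-! ### Degrees in finite edge sets, and the purchase process. -/

/-- The number of edges of `B` that contain `v`. -/
def edgeDeg {n : ℕ} (B : Finset (Sym2 (Fin n))) (v : Fin n) : ℕ := (B.filter (v ∈ ·)).card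

section EdgeDeg

variable {n : ℕ}

theorem edgeDeg_mono {B C : Finset (Sym2 (Fin n))} (h : B ⊆ C) (v : Fin n) :
    edgeDeg B v ≤ edgeDeg C v :=
  Finset.card_le_card (Finset.filter_subset_filter _ h)

theorem edgeDeg_insert_of_notMem {B : Finset (Sym2 (Fin n))} {e : Sym2 (Fin n)} {v : Fin n}
    (h : v ∉ e) : edgeDeg (insert e B) v = edgeDeg B v := by
  unfold edgeDeg; rw [Finset.filter_insert, if_neg h]

theorem edgeDeg_insert_le (B : Finset (Sym2 (Fin n))) (e : Sym2 (Fin n)) (v : Fin n) :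
    edgeDeg (insert e B) v ≤ edgeDeg B v + 1 := by
  unfold edgeDeg
  rw [Finset.filter_insert]
  split_ifs
  · exact Finset.card_insert_le _ _
  · omega

theorem edgeDeg_insert_of_mem {B : Finset (Sym2 (Fin n))} {e : Sym2 (Fin n)} {v : Fin n}
    (he : e ∉ B) (h : v ∈ e) : edgeDeg (insert e B) v = edgeDeg B v + 1 := by
  unfold edgeDeg
  rw [Finset.filter_insert, if_pos h, Finset.card_insert_of_notMem (by simp [he])]

theorem card_filter_mem_of_not_isDiag {e : Sym2 (Fin n)} (he : ¬ e.IsDiag) :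
    (Finset.univ.filter (· ∈ e)).card = 2 := by
  induction e using Sym2.ind with
  | _ x y =>
    have hxy : x ≠ y := by simpa using he
    have : Finset.univ.filter (· ∈ s(x, y)) = {x, y} := by ext z; simp
    rw [this, Finset.card_pair hxy]

theorem sum_edgeDeg {B : Finset (Sym2 (Fin n))} (hB : ∀ e ∈ B, ¬ e.IsDiag) :
    ∑ v, edgeDeg B v = 2 * B.card := by
  unfold edgeDeg
  refine (Finset.sum_card_bipartiteAbove_eq_sum_card_bipartiteBelow
    (fun (v : Fin n) e => v ∈ e)).trans ?_
  rw [mul_comm, ← smul_eq_mul, ← Finset.sum_const]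
  exact Finset.sum_congr rfl fun e he => card_filter_mem_of_not_isDiag (hB e he)

theorem edgeDeg_eq_degree {B : Finset (Sym2 (Fin n))} (hB : ∀ e ∈ B, ¬ e.IsDiag) (v : Fin n)
    (G : SimpleGraph (Fin n)) [DecidableRel G.Adj]
    (hG : G = SimpleGraph.fromEdgeSet (B : Set (Sym2 (Fin n)))) : edgeDeg B v = G.degree v := by
  rw [← SimpleGraph.card_incidenceFinset_eq_degree]
  unfold edgeDeg
  congr 1
  ext e
  rw [SimpleGraph.mem_incidenceFinset, SimpleGraph.incidenceSet, Set.mem_ofPred_eq, hG,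
    SimpleGraph.edgeSet_fromEdgeSet, Finset.mem_filter]
  constructor
  · rintro ⟨h1, h2⟩
    exact ⟨⟨h1, by simpa using hB e h1⟩, h2⟩
  · rintro ⟨⟨h1, -⟩, h2⟩
    exact ⟨h1, h2⟩

theorem le_minDeg_iff {B : Finset (Sym2 (Fin n))} (hB : ∀ e ∈ B, ¬ e.IsDiag) (hn : 0 < n) (k : ℕ) :
    k ≤ minDeg (SimpleGraph.fromEdgeSet (B : Set (Sym2 (Fin n)))) ↔ ∀ v, k ≤ edgeDeg B v := by
  classical
  have : Nonempty (Fin n) := ⟨⟨0, hn⟩⟩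
  generalize hG : SimpleGraph.fromEdgeSet (B : Set (Sym2 (Fin n))) = G
  simp_rw [fun v => edgeDeg_eq_degree hB v G hG.symm]
  unfold minDeg
  exact ⟨fun h v => h.trans (G.minDegree_le_degree v), G.le_minDegree_of_forall_le_degree k⟩

end EdgeDeg

section Purchased

variable {n : ℕ} (σ : DecisionRule n) (π : EdgeOrder n)

theorem purchased_subset_succ (s : ℕ) : purchased σ π s ⊆ purchased σ π (s + 1) := by
  rw [purchased]
  split_ifs
  · exact Finset.subset_insert _ _
  · rfl
  · rfl

theorem purchased_mono : Monotone (purchased σ π) :=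
  monotone_nat_of_le_succ (purchased_subset_succ σ π)

theorem not_isDiag_of_mem_purchased (s : ℕ) : ∀ e ∈ purchased σ π s, ¬ e.IsDiag := by
  induction s with
  | zero => simp [purchased]
  | succ s ih =>
    rw [purchased]
    split_ifs
    · intro e he
      rcases Finset.mem_insert.1 he with rfl | h
      · exact (π _).2
      · exact ih e h
    · exact ih
    · exact ih

/-- Case distinction for one step of the process. -/
theorem purchased_succ_cases (s : ℕ) : purchased σ π (s + 1) = purchased σ π s ∨
    ∃ e, σ (s + 1) (purchased σ π s) e = true ∧
      purchased σ π (s + 1) = insert e (purchased σ π s) := by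
  rw [purchased]
  split_ifs with h1 h2
  · exact Or.inr ⟨_, h2, rfl⟩
  · exact Or.inl rfl
  · exact Or.inl rfl

theorem mem_purchased_of_rule {i : Fin (Fintype.card (Edge n))} {s : ℕ} (hi : i.val < s)
    (h : σ (i.val + 1) (purchased σ π i.val) (π i).val = true) :
    (π i).val ∈ purchased σ π s := by
  refine purchased_mono σ π (Nat.succ_le_of_lt hi) ?_
  rw [Nat.succ_eq_add_one, purchased, dif_pos i.2, if_pos h]
  exact Finset.mem_insert_self _ _

end Purchased

/-! ### The two-phase strategy: deterministic analysis. -/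

/-- Builder's two-phase rule. Up to time `t₁` he buys an edge when both endpoints have degree less
than `k`; later he buys an edge when at least one endpoint has degree less than `k`. He never
exceeds the budget `b`. -/
def twoPhaseRule (n k t₁ b : ℕ) : DecisionRule n := fun s B e =>
  decide (B.card < b ∧ if s ≤ t₁ then ∀ v ∈ e, edgeDeg B v < k else ∃ v ∈ e, edgeDeg B v < k)

theorem card_purchased_twoPhaseRule_le {n : ℕ} (k t₁ b : ℕ) (π : EdgeOrder n) (s : ℕ) :
    (purchased (twoPhaseRule n k t₁ b) π s).card ≤ b := by
  induction s with
  | zero => simp [purchased]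
  | succ s ih =>
    rcases purchased_succ_cases (twoPhaseRule n k t₁ b) π s with h | ⟨e, he, h⟩
    · rwa [h]
    · rw [h]
      have := (of_decide_eq_true he).1
      exact (Finset.card_insert_le _ _).trans this

/-- The two-phase rule as a strategy. -/
def twoPhaseStrategy (n k t₁ t b : ℕ) : DetStrategy n t b where
  rule := twoPhaseRule n k t₁ b
  budget π s _ := card_purchased_twoPhaseRule_le k t₁ b π s

/-- The edges inside the vertex set `U`. -/
def edgesIn {n : ℕ} (U : Finset (Fin n)) : Finset (Edge n) :=
  Finset.univ.filter fun e => ∀ v ∈ e.val, v ∈ U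

/-- The edges at the vertex `v`. -/
def edgesAt {n : ℕ} (v : Fin n) : Finset (Edge n) :=
  Finset.univ.filter fun e => v ∈ e.val

/-- The positions in the interval `[s, t)`. -/
def positions (n s t : ℕ) : Finset (Fin (Fintype.card (Edge n))) :=
  Finset.univ.filter fun i => s ≤ i.val ∧ i.val < t

section TwoPhase

variable {n k t₁ b : ℕ} (π : EdgeOrder n)

theorem edgeDeg_purchased_le {s : ℕ} (hs : s ≤ t₁) (v : Fin n) :
    edgeDeg (purchased (twoPhaseRule n k t₁ b) π s) v ≤ k := by
  induction s with
  | zero => simp [purchased, edgeDeg]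
  | succ s ih =>
    have ih := ih (by omega)
    rcases purchased_succ_cases (twoPhaseRule n k t₁ b) π s with h | ⟨e, he, h⟩
    · rwa [h]
    · rw [h]
      have h2 := (of_decide_eq_true he).2
      rw [if_pos hs] at h2
      by_cases hv : v ∈ e
      · exact (edgeDeg_insert_le _ e v).trans (h2 v hv)
      · rwa [edgeDeg_insert_of_notMem hv]

theorem two_mul_card_purchased_le {s : ℕ} (hs : s ≤ t₁) :
    2 * (purchased (twoPhaseRule n k t₁ b) π s).card ≤ k * n := by
  rw [← sum_edgeDeg (not_isDiag_of_mem_purchased _ π s)]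
  refine (Finset.sum_le_card_nsmul _ _ k fun v _ => edgeDeg_purchased_le π hs v).trans ?_
  simp [mul_comm]

/-- Edges bought plus total deficiency is a potential that cannot grow in the second phase: a new
edge costs one and reduces the deficiency of some endpoint. -/
theorem potential_succ_le {s : ℕ} (hs : t₁ ≤ s) :
    (purchased (twoPhaseRule n k t₁ b) π (s + 1)).card +
        ∑ v, (k - edgeDeg (purchased (twoPhaseRule n k t₁ b) π (s + 1)) v) ≤
      (purchased (twoPhaseRule n k t₁ b) π s).card +
        ∑ v, (k - edgeDeg (purchased (twoPhaseRule n k t₁ b) π s) v) := by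
  rcases purchased_succ_cases (twoPhaseRule n k t₁ b) π s with h | ⟨e, he, h⟩
  · rw [h]
  · rw [h]
    have h2 := (of_decide_eq_true he).2
    rw [if_neg (by omega)] at h2
    obtain ⟨v, hv, hvk⟩ := h2
    set B := purchased (twoPhaseRule n k t₁ b) π s
    by_cases heB : e ∈ B
    · rw [Finset.insert_eq_of_mem heB]
    · have hlt : ∑ v, (k - edgeDeg (insert e B) v) < ∑ v, (k - edgeDeg B v) := by
        refine Finset.sum_lt_sum (fun w _ => ?_) ⟨v, Finset.mem_univ v, ?_⟩
        · have := edgeDeg_mono (Finset.subset_insert e B) w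
          omega
        · rw [edgeDeg_insert_of_mem heB hv]
          omega
      rw [Finset.card_insert_of_notMem heB]
      omega

theorem potential_le {s : ℕ} (hs : t₁ ≤ s) :
    (purchased (twoPhaseRule n k t₁ b) π s).card +
        ∑ v, (k - edgeDeg (purchased (twoPhaseRule n k t₁ b) π s) v) ≤
      (purchased (twoPhaseRule n k t₁ b) π t₁).card +
        ∑ v, (k - edgeDeg (purchased (twoPhaseRule n k t₁ b) π t₁) v) := by
  induction s, hs using Nat.le_induction with
  | base => exact le_rfl
  | succ s hs ih => exact (potential_succ_le π hs).trans ih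

/-- Degrees only grow, so a vertex deficient at time `t₁` was deficient throughout. Every edge
presented between two such vertices was therefore bought, and a large deficient set would need more
than the `kn/2` edges available. -/
theorem card_deficient_le {u : ℕ} (hu : 1 ≤ u) (hk : 1 ≤ k) (hb : k * n + 2 * (k * u) ≤ 2 * b)
    (hU : ∀ U : Finset (Fin n), u < U.card →
      k * n < 2 * (hits (positions n 0 t₁) (edgesIn U) π).card) :
    (Finset.univ.filter fun v => edgeDeg (purchased (twoPhaseRule n k t₁ b) π t₁) v < k).card
      ≤ u := by
  by_contra! hcon
  have h1 := hU _ hcon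
  refine absurd h1 (not_lt.2 (le_trans ?_ 
    (two_mul_card_purchased_le (b := b) (t₁ := t₁) π le_rfl)))
  refine Nat.mul_le_mul_left 2 (Finset.card_le_card_of_injOn (fun i => (π i).val) ?_ ?_)
  · intro i hi
    obtain ⟨hi1, hi2⟩ := Finset.mem_filter.1 (Finset.mem_coe.1 hi)
    have hi1 := (Finset.mem_filter.1 hi1).2.2
    have hi2 := (Finset.mem_filter.1 hi2).2
    refine mem_purchased_of_rule _ π hi1 (decide_eq_true ⟨?_, ?_⟩)
    · have := two_mul_card_purchased_le (k := k) (b := b) π hi1.le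
      -- Makes the budget inequality strict, so that one more edge may be bought.
      have : 1 ≤ k * u := Nat.mul_pos hk hu
      omega
    · rw [if_pos (Nat.succ_le_of_lt hi1)]
      intro v hv
      exact (edgeDeg_mono (purchased_mono _ π hi1.le) v).trans_lt
        (Finset.mem_filter.1 (hi2 v hv)).2
  · exact fun i _ j _ h => π.injective (Subtype.ext h)

theorem le_minDeg_twoPhase {u t₂ t : ℕ} (hn : 0 < n) (hu : 1 ≤ u) (hk : 1 ≤ k)
    (hb : k * n + 2 * (k * u) ≤ 2 * b) (ht : t₂ ≤ t)
    (hU : ∀ U : Finset (Fin n), u < U.card →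
      k * n < 2 * (hits (positions n 0 t₁) (edgesIn U) π).card)
    (hv : ∀ v : Fin n, k ≤ (hits (positions n t₁ t₂) (edgesAt v) π).card) :
    k ≤ minDeg (SimpleGraph.fromEdgeSet
      (purchased (twoPhaseRule n k t₁ b) π t : Set (Sym2 (Fin n)))) := by
  rw [le_minDeg_iff (not_isDiag_of_mem_purchased _ π t) hn]
  intro v
  refine le_trans ?_ (edgeDeg_mono (purchased_mono _ π ht) v)
  by_contra! hcon
  refine absurd hcon (not_lt.2 ((hv v).trans ?_))
  refine Finset.card_le_card_of_injOn (fun i => (π i).val) ?_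
    (fun i _ j _ h => π.injective (Subtype.ext h))
  intro i hi
  obtain ⟨hi1, hi2⟩ := Finset.mem_filter.1 (Finset.mem_coe.1 hi)
  obtain ⟨hi0, hi1⟩ := (Finset.mem_filter.1 hi1).2
  have hi2 := (Finset.mem_filter.1 hi2).2
  -- If `v` is deficient at `t₂`, it is deficient at every earlier time, so each of its edges in the
  -- window is bought; the remaining condition is the budget.
  have hvk : edgeDeg (purchased (twoPhaseRule n k t₁ b) π i.val) v < k :=
    (edgeDeg_mono (purchased_mono _ π hi1.le) v).trans_lt hcon
  refine Finset.mem_coe.2 (Finset.mem_filter.2 ⟨mem_purchased_of_rule _ π hi1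
    (decide_eq_true ⟨?_, ?_⟩), hi2⟩)
  · have h1 := potential_le (k := k) (b := b) π hi0
    have h2 := two_mul_card_purchased_le (k := k) (b := b) (t₁ := t₁) π le_rfl
    have h3 : ∑ v, (k - edgeDeg (purchased (twoPhaseRule n k t₁ b) π t₁) v) ≤ k * u := by
      calc _ ≤ ∑ v, if edgeDeg (purchased (twoPhaseRule n k t₁ b) π t₁) v < k then k else 0 := by
            refine Finset.sum_le_sum fun v _ => ?_
            split_ifs <;> omega
        _ = k * (Finset.univ.filter fun v =>
              edgeDeg (purchased (twoPhaseRule n k t₁ b) π t₁) v < k).card := by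
            rw [← Finset.sum_filter, Finset.sum_const, smul_eq_mul, mul_comm]
        _ ≤ k * u := Nat.mul_le_mul_left k (card_deficient_le π hu hk hb hU)
    -- The deficiency of `v` itself is at least one, so the potential bound leaves room for one more
    -- edge.
    have h4 : k - edgeDeg (purchased (twoPhaseRule n k t₁ b) π i.val) v ≤
        ∑ v, (k - edgeDeg (purchased (twoPhaseRule n k t₁ b) π i.val) v) :=
      Finset.single_le_sum
        (f := fun v => k - edgeDeg (purchased (twoPhaseRule n k t₁ b) π i.val) v)
        (fun _ _ => Nat.zero_le _) (Finset.mem_univ v)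
    omega
  · rw [if_neg (by omega)]
    exact ⟨v, hi2, hvk⟩

end TwoPhase

/-! ### Numbers of edges and positions. -/

section Counting

variable {n : ℕ}

theorem card_edge (n : ℕ) : Fintype.card (Edge n) = n.choose 2 := by
  rw [Sym2.card_subtype_not_diag, Fintype.card_fin]

theorem card_edge_real (n : ℕ) : (Fintype.card (Edge n) : ℝ) = (n : ℝ) * (n - 1) / 2 := by
  rw [card_edge, Nat.cast_choose_two]

theorem card_edgesIn (U : Finset (Fin n)) : (edgesIn U).card = U.card.choose 2 := by
  rw [← Sym2.card_image_offDiag U, ← Finset.card_map (Function.Embedding.subtype _)]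
  congr 1
  ext e
  induction e using Sym2.ind with
  | _ x y =>
    simp only [edgesIn, Finset.mem_map, Finset.mem_filter, Finset.mem_univ, true_and,
      Function.Embedding.coe_subtype, Subtype.exists, exists_and_right, exists_eq_right,
      Finset.mem_image, Finset.mem_offDiag, Prod.exists, Function.uncurry_apply_pair]
    constructor
    · rintro ⟨h, hU⟩
      exact ⟨x, y, ⟨hU x (by simp), hU y (by simp), by simpa using h⟩, rfl⟩
    · rintro ⟨a, b, ⟨ha, hb, hab⟩, h⟩
      rw [← h]
      exact ⟨by simpa using hab, by simp [ha, hb]⟩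

theorem card_edgesAt (v : Fin n) : (edgesAt v).card = n - 1 := by
  have : (edgesAt v).card = (Finset.univ.erase v).card := by
    symm
    refine Finset.card_bij
      (fun w hw => ⟨s(v, w), by simpa using (Finset.ne_of_mem_erase hw).symm⟩) ?_ ?_ ?_
    · intro w hw
      simp [edgesAt]
    · intro a _ b _ h
      exact Sym2.congr_right.1 (Subtype.ext_iff.1 h)
    · rintro ⟨e, he⟩ h
      obtain ⟨w, rfl⟩ := (Finset.mem_filter.1 h).2
      exact ⟨w, by simpa using fun h => he (by simp [h]), rfl⟩
  rw [this, Finset.card_erase_of_mem (Finset.mem_univ v), Finset.card_univ, Fintype.card_fin]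

theorem card_edgesAt_union {u v : Fin n} (huv : u ≠ v) :
    (edgesAt u ∪ edgesAt v).card + 1 = 2 * (n - 1) := by
  -- Two stars share exactly the edge joining their centres.
  have h : (edgesAt u ∩ edgesAt v).card = 1 := by
    rw [Finset.card_eq_one]
    refine ⟨⟨s(u, v), by simpa using huv⟩, ?_⟩
    ext e
    simp only [edgesAt, Finset.mem_inter, Finset.mem_filter, Finset.mem_univ, true_and,
      Finset.mem_singleton, Subtype.ext_iff]
    exact Sym2.mem_and_mem_iff huv
  have := Finset.card_union_add_card_inter (edgesAt u) (edgesAt v)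
  rw [card_edgesAt, card_edgesAt, h] at this
  omega

theorem card_positions {s t : ℕ} (ht : t ≤ Fintype.card (Edge n)) :
    (positions n s t).card = t - s := by
  rw [← Nat.card_Ico, ← Finset.card_map Fin.valEmbedding]
  congr 1
  ext i
  simp only [positions, Finset.mem_map, Finset.mem_filter, Finset.mem_univ, true_and,
    Fin.valEmbedding_apply, Finset.mem_Ico]
  constructor
  · rintro ⟨j, h, rfl⟩
    exact h
  · intro h
    exact ⟨⟨i, h.2.trans_le ht⟩, h, rfl⟩

end Counting

/-! ### Optimality of the budget. -/

/-- A strategy with fewer than `k n / 2` edges never reaches minimum degree `k`. -/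
theorem graphProb_le_minDeg_eq_zero {k n t b : ℕ}
    (hb : (b : ℝ) < (k : ℝ) * (n : ℝ) / 2) (S : Strategy n t b) :
    graphProb (builderLaw S) {G | k ≤ minDeg G} = 0 := by
  have hn : 0 < n := by
    rcases Nat.eq_zero_or_pos n with rfl | h
    · have : (0:ℝ) ≤ b := Nat.cast_nonneg b
      simp at hb
      linarith
    · exact h
  rw [graphProb, PMF.toOuterMeasure_apply_eq_zero_iff, Set.disjoint_left]
  intro G hG hk'
  rw [builderLaw, PMF.mem_support_bind_iff] at hG
  obtain ⟨σ, -, hG⟩ := hG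
  rw [PMF.mem_support_map_iff] at hG
  obtain ⟨π, -, rfl⟩ := hG
  have hd := not_isDiag_of_mem_purchased σ.rule π t
  rw [Set.mem_ofPred_eq, le_minDeg_iff hd hn] at hk'
  have h1 : n * k ≤ 2 * (purchased σ.rule π t).card := by
    rw [← sum_edgeDeg hd]
    simpa using Finset.card_nsmul_le_sum Finset.univ _ k fun v _ => hk' v
  have h2 := σ.budget π t le_rfl
  have h3 : n * k ≤ 2 * b := by omega
  have h4 : (n : ℝ) * k ≤ 2 * b := by exact_mod_cast h3
  linarith

/-! ### Probabilities over the edge order. -/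

open Classical in
/-- The probability of an event about the uniformly random order of the edges. -/
noncomputable def orderProb (n : ℕ) (A : EdgeOrder n → Prop) : ℝ :=
  (Finset.univ.filter A).card / Fintype.card (EdgeOrder n)

section OrderProb

variable {n : ℕ}

theorem orderProb_eq (A : EdgeOrder n → Prop) [DecidablePred A] :
    orderProb n A = (Finset.univ.filter A).card / Fintype.card (EdgeOrder n) := by
  unfold orderProb
  congr!

theorem card_edgeOrder_pos (n : ℕ) : (0 : ℝ) < Fintype.card (EdgeOrder n) := by
  exact_mod_cast Fintype.card_pos

theorem orderProb_le_one (A : EdgeOrder n → Prop) : orderProb n A ≤ 1 := by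
  classical
  unfold orderProb
  rw [div_le_one (card_edgeOrder_pos n)]
  exact_mod_cast Finset.card_le_univ _

theorem orderProb_mono {A B : EdgeOrder n → Prop} (h : ∀ π, A π → B π) :
    orderProb n A ≤ orderProb n B := by
  classical
  rw [orderProb_eq, orderProb_eq]
  refine div_le_div_of_nonneg_right ?_ (card_edgeOrder_pos n).le
  exact_mod_cast Finset.card_le_card (Finset.monotone_filter_right _ fun π _ => h π)

theorem orderProb_not (A : EdgeOrder n → Prop) :
    orderProb n A = 1 - orderProb n (fun π => ¬ A π) := by
  classical
  rw [orderProb_eq, orderProb_eq]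
  rw [eq_sub_iff_add_eq, ← add_div, div_eq_one_iff_eq (card_edgeOrder_pos n).ne']
  exact_mod_cast Finset.card_filter_add_card_filter_not (s := Finset.univ) A

theorem orderProb_or_le (A B : EdgeOrder n → Prop) :
    orderProb n (fun π => A π ∨ B π) ≤ orderProb n A + orderProb n B := by
  classical
  rw [orderProb_eq, orderProb_eq, orderProb_eq, ← add_div]
  refine div_le_div_of_nonneg_right ?_ (card_edgeOrder_pos n).le
  rw [Finset.filter_or]
  exact_mod_cast Finset.card_union_le _ _

theorem orderProb_exists_le {ι : Type*} (s : Finset ι) (A : ι → EdgeOrder n → Prop) {c : ℝ}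
    (h : ∀ i ∈ s, orderProb n (A i) ≤ c) :
    orderProb n (fun π => ∃ i ∈ s, A i π) ≤ s.card * c := by
  classical
  have h1 : orderProb n (fun π => ∃ i ∈ s, A i π) ≤ ∑ i ∈ s, orderProb n (A i) := by
    simp_rw [orderProb_eq]
    rw [← Finset.sum_div]
    refine div_le_div_of_nonneg_right ?_ (card_edgeOrder_pos n).le
    have : (Finset.univ.filter fun π => ∃ i ∈ s, A i π) =
        s.biUnion fun i => Finset.univ.filter (A i) := by
      ext π; simp
    rw [this]
    exact_mod_cast Finset.card_biUnion_le
  refine h1.trans ((Finset.sum_le_sum h).trans ?_)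
  rw [Finset.sum_const, nsmul_eq_mul]

theorem orderProb_hits_le_le (J : Finset (Fin (Fintype.card (Edge n)))) (S : Finset (Edge n))
    {j : ℕ} {x : ℝ} (hx0 : 0 < x) (hx1 : x ≤ 1) (hjS : j ≤ S.card) :
    orderProb n (fun π => (hits J S π).card ≤ j) ≤
      (x⁻¹) ^ j *
        Real.exp (-((1 - x) * ((S.card : ℝ) - j) / Fintype.card (Edge n) * J.card)) := by
  rw [orderProb_eq, div_le_iff₀ (card_edgeOrder_pos n)]
  convert! card_hits_le_le S j hx0 hx1 hjS (Fintype.card_fin _) J using 4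
  rw [Fintype.card_fin]

theorem graphProb_map_uniform (f : EdgeOrder n → SimpleGraph (Fin n))
    (A : Set (SimpleGraph (Fin n))) :
    graphProb ((PMF.uniformOfFintype (EdgeOrder n)).map f) A =
      ENNReal.ofReal (orderProb n (fun π => f π ∈ A)) := by
  classical
  rw [graphProb, PMF.toOuterMeasure_map_apply, PMF.toOuterMeasure_uniformOfFintype_apply, orderProb_eq,
    ENNReal.ofReal_div_of_pos (card_edgeOrder_pos n), ENNReal.ofReal_natCast,
    ENNReal.ofReal_natCast, Fintype.card_subtype]
  congr!

theorem tendsto_ofReal_orderProb {A : (n : ℕ) → EdgeOrder n → Prop} {r : ℕ → ℝ}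
    (hr : Tendsto r atTop (𝓝 1)) (h : ∀ᶠ n in atTop, r n ≤ orderProb n (A n)) :
    Tendsto (fun n => ENNReal.ofReal (orderProb n (A n))) atTop (𝓝 1) := by
  rw [← ENNReal.ofReal_one]
  exact ENNReal.tendsto_ofReal (tendsto_of_tendsto_of_tendsto_of_le_of_le' hr tendsto_const_nhds h
    (Eventually.of_forall fun n => orderProb_le_one _))

end OrderProb

/-! ### The two-phase strategy: probability estimates and asymptotics. -/

/-- Failure probability of the two-phase strategy. -/
theorem orderProb_twoPhase {n k u t₁ m t b : ℕ} {x y : ℝ} (hn : 0 < n) (hu : 1 ≤ u) (hk : 1 ≤ k)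
    (hkn : k ≤ n - 1) (hb : k * n + 2 * (k * u) ≤ 2 * b) (ht : t₁ + m ≤ t)
    (hN : t₁ + m ≤ Fintype.card (Edge n)) (hx0 : 0 < x) (hx1 : x ≤ 1)
    (hU : ∀ U : Finset (Fin n), u < U.card → k * n ≤ (edgesIn U).card)
    (hy : ∀ U : Finset (Fin n), u < U.card →
      y ≤ (((edgesIn U).card : ℝ) - (k * n : ℕ)) / Fintype.card (Edge n)) :
    1 - (2 ^ n * (2 ^ (k * n) * Real.exp (-(1 / 2 * y * t₁))) +
        n * ((x⁻¹) ^ k * Real.exp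
          (-((1 - x) * (((n - 1 : ℕ) : ℝ) - k) / Fintype.card (Edge n) * m)))) ≤
      orderProb n (fun π => k ≤ minDeg (SimpleGraph.fromEdgeSet
        (purchased (twoPhaseRule n k t₁ b) π t : Set (Sym2 (Fin n))))) := by
  classical
  rw [orderProb_not]
  refine sub_le_sub_left ?_ 1
  set 𝒰 : Finset (Finset (Fin n)) := Finset.univ.filter fun U => u < U.card with h𝒰
  -- The thresholds `k * n` and `≤ k` are more than the deterministic analysis requires (`kn/2` and
  -- `< k`); the slack is harmless and avoids halves and predecessors.
  refine (orderProb_mono (B := fun π =>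
    (∃ U ∈ 𝒰, (hits (positions n 0 t₁) (edgesIn U) π).card ≤ k * n) ∨
    (∃ v ∈ (Finset.univ : Finset (Fin n)),
      (hits (positions n t₁ (t₁ + m)) (edgesAt v) π).card ≤ k)) ?_).trans
    ((orderProb_or_le _ _).trans (add_le_add ?_ ?_))
  · intro π hπ
    by_contra! hcon
    refine hπ (le_minDeg_twoPhase π hn hu hk hb ht (fun U hU => ?_) (fun v => ?_))
    · have := hcon.1 U (by simp [h𝒰, hU])
      omega
    · exact (hcon.2 v (Finset.mem_univ v)).le
  · refine (orderProb_exists_le (c := 2 ^ (k * n) * Real.exp (-(1 / 2 * y * t₁))) 𝒰 _ ?_).trans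
      (mul_le_mul_of_nonneg_right ?_ (by positivity))
    · intro U hUm
      have hUu : u < U.card := (Finset.mem_filter.1 hUm).2
      refine (orderProb_hits_le_le _ _ (x := 1 / 2) (by norm_num) (by norm_num) (hU U hUu)).trans ?_
      rw [card_positions (by omega)]
      rw [one_div, inv_inv]
      refine mul_le_mul_of_nonneg_left (Real.exp_le_exp.2 (neg_le_neg ?_)) (by positivity)
      rw [Nat.sub_zero, mul_div_assoc]
      refine mul_le_mul_of_nonneg_right ?_ (Nat.cast_nonneg _)
      have := hy U hUu
      linarith
    · have : 𝒰.card ≤ 2 ^ n := by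
        refine (Finset.card_le_univ 𝒰).trans ?_
        simp
      exact_mod_cast this
  · have h := orderProb_exists_le (n := n) Finset.univ
      (fun v π => (hits (positions n t₁ (t₁ + m)) (edgesAt v) π).card ≤ k)
      (c := (x⁻¹) ^ k * Real.exp
          (-((1 - x) * (((n - 1 : ℕ) : ℝ) - k) / Fintype.card (Edge n) * m))) (fun v _ => by
        have h := orderProb_hits_le_le (positions n t₁ (t₁ + m)) (edgesAt v) hx0 hx1
          (j := k) (by rwa [card_edgesAt])
        rwa [card_edgesAt, card_positions hN, Nat.add_sub_cancel_left] at h)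
    rwa [Finset.card_univ, Fintype.card_fin] at h

theorem tendsto_log_natCast : Tendsto (fun n : ℕ => Real.log n) atTop atTop :=
  Real.tendsto_log_atTop.comp tendsto_natCast_atTop_atTop

theorem eventually_const_le_natCast (c : ℝ) : ∀ᶠ n : ℕ in atTop, c ≤ n :=
  tendsto_natCast_atTop_atTop.eventually_ge_atTop c

theorem eventually_const_le_log (c : ℝ) : ∀ᶠ n : ℕ in atTop, c ≤ Real.log n :=
  tendsto_log_natCast.eventually_ge_atTop c

theorem eventually_log_le_mul {c : ℝ} (hc : 0 < c) : ∀ᶠ n : ℕ in atTop, Real.log n ≤ c * n := by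
  have h := (Real.isLittleO_log_id_atTop.comp_tendsto tendsto_natCast_atTop_atTop).bound hc
  filter_upwards [h, eventually_const_le_log 0] with n hn h0
  simpa [abs_of_nonneg h0] using hn

/-- Vertex sets of linear size contain a positive fraction of all edges. -/
theorem eventually_linear_set_spans (k : ℕ) {η : ℝ} (hη : 0 < η) :
    ∀ᶠ n : ℕ in atTop, ∀ U : Finset (Fin n), ⌊η * n⌋₊ < U.card →
      k * n ≤ (edgesIn U).card ∧
      η ^ 2 / 4 ≤ (((edgesIn U).card : ℝ) - (k * n : ℕ)) / Fintype.card (Edge n) := by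
  -- The second threshold is `3η²n/8 ≥ η/2 + k`, which gives `ηn(ηn - 1)/2 ≥ η²n²/8 + kn`. Dividing
  -- the surplus `η²n²/8` by fewer than `n²/2` edges leaves `η²/4`.
  filter_upwards [eventually_const_le_natCast 2,
    eventually_const_le_natCast ((η / 2 + k) * 8 / (3 * η ^ 2))] with n hn2 hn U hU
  have hU' : η * n < U.card := Nat.lt_of_floor_lt hU
  rw [div_le_iff₀ (by positivity)] at hn
  have hs : ((edgesIn U).card : ℝ) = (U.card : ℝ) * (U.card - 1) / 2 := by
    rw [card_edgesIn, Nat.cast_choose_two]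
  have hU1 : (1 : ℝ) ≤ U.card := by exact_mod_cast (Nat.zero_le _).trans_lt hU
  have hs' : (η * n) * (η * n - 1) / 2 ≤ ((edgesIn U).card : ℝ) := by
    rw [hs]
    have : 0 ≤ η * n := by positivity
    nlinarith
  have hmain : η ^ 2 * n ^ 2 / 8 + k * n ≤ ((edgesIn U).card : ℝ) := by
    refine le_trans ?_ hs'
    have := mul_le_mul_of_nonneg_right hn (by linarith : (0 : ℝ) ≤ n)
    nlinarith
  have hN0 : (0 : ℝ) < Fintype.card (Edge n) := by
    rw [card_edge_real]
    have : (0:ℝ) < n - 1 := by linarith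
    positivity
  constructor
  · have : (k * n : ℝ) ≤ ((edgesIn U).card : ℝ) := by
      have : 0 ≤ η ^ 2 * (n : ℝ) ^ 2 / 8 := by positivity
      linarith
    exact_mod_cast this
  · rw [le_div_iff₀ hN0, card_edge_real]
    push_cast
    have : 0 ≤ η ^ 2 / 8 * n := by positivity
    nlinarith

/-- The union bound and the tail prefactor cost only `exp (O(n))`, while the exponent is of order `n
log n`, however small `c` and `y` are. -/
theorem eventually_first_phase_bound (k : ℕ) {c y : ℝ} (hc : 0 < c) (hy : 0 < y) :
    ∀ᶠ n : ℕ in atTop, (2 : ℝ) ^ n * (2 ^ (k * n) *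
      Real.exp (-(1 / 2 * y * (⌈c * (n * Real.log n)⌉₊ : ℕ)))) ≤ Real.exp (-n) := by
  filter_upwards [eventually_const_le_log ((k + 2) * (2 / (c * y)))] with n hn
  have h2 : (2 : ℝ) ≤ Real.exp 1 := by
    have := Real.add_one_le_exp (1 : ℝ)
    linarith
  have h2n : ∀ j : ℕ, (2 : ℝ) ^ j ≤ Real.exp j := by
    intro j
    calc (2 : ℝ) ^ j ≤ (Real.exp 1) ^ j := pow_le_pow_left₀ (by norm_num) h2 j
      _ = Real.exp j := by rw [← Real.exp_nat_mul, mul_one]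
  calc _ ≤ Real.exp n * (Real.exp (k * n : ℕ) *
        Real.exp (-(1 / 2 * y * (⌈c * (n * Real.log n)⌉₊ : ℕ)))) := by
        gcongr
        · exact h2n n
        · exact h2n (k * n)
    _ = Real.exp (n + ((k * n : ℕ) + -(1 / 2 * y * (⌈c * (n * Real.log n)⌉₊ : ℕ)))) := by
        rw [Real.exp_add, Real.exp_add]
    _ ≤ Real.exp (-n) := by
        refine Real.exp_le_exp.2 ?_
        have h1 := Nat.le_ceil (c * (n * Real.log n))
        have h3 : (k + 2) ≤ c * y / 2 * Real.log n := by
          have := mul_le_mul_of_nonneg_left hn (by positivity : 0 ≤ c * y / 2)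
          refine le_trans (le_of_eq ?_) this
          field_simp
        have h4 := mul_le_mul_of_nonneg_right h3 (Nat.cast_nonneg n : (0 : ℝ) ≤ n)
        have h5 := mul_le_mul_of_nonneg_left h1 (by positivity : 0 ≤ 1 / 2 * y)
        push_cast
        nlinarith

/-- The exponent is `(1 - x) c log n` up to the factor `(n - 1 - k)/(n - 1)`, which tends to one;
the gap between `d` and `(1 - x) c` absorbs it. -/
theorem eventually_second_phase_bound (k : ℕ) {x c d : ℝ} (hx0 : 0 < x) (hx1 : x < 1) (hc : 0 < c)
    (hd : d < (1 - x) * c) :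
    ∀ᶠ n : ℕ in atTop, (n : ℝ) * ((x⁻¹) ^ k * Real.exp
      (-((1 - x) * (((n - 1 : ℕ) : ℝ) - k) / Fintype.card (Edge n) *
        (⌈c * (n * Real.log n) / 2⌉₊ : ℕ)))) ≤ (x⁻¹) ^ k * Real.exp ((1 - d) * Real.log n) := by
  have hx : 0 < 1 - x := by linarith
  filter_upwards [eventually_const_le_natCast 2, eventually_const_le_natCast (k + 1),
    eventually_const_le_log 0,
    eventually_const_le_natCast (1 + (1 - x) * c * k / ((1 - x) * c - d))] with n hn2 hnk hL hn
  have hn0 : (0 : ℝ) < n := by linarith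
  have hn1 : (0 : ℝ) < n - 1 := by linarith
  have hcast : ((n - 1 : ℕ) : ℝ) = n - 1 := by
    rw [Nat.cast_sub (by exact_mod_cast (by linarith : (1 : ℝ) ≤ n)), Nat.cast_one]
  have hm := Nat.le_ceil (c * (n * Real.log n) / 2)
  have hexp : d * Real.log n ≤ (1 - x) * (((n - 1 : ℕ) : ℝ) - k) / Fintype.card (Edge n) *
        (⌈c * (n * Real.log n) / 2⌉₊ : ℕ) := by
    have hnk' : (0 : ℝ) ≤ n - 1 - k := by linarith
    rw [hcast, card_edge_real]
    calc d * Real.log n ≤ (1 - x) * c * (n - 1 - k) / (n - 1) * Real.log n := by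
          refine mul_le_mul_of_nonneg_right ?_ hL
          rw [le_div_iff₀ hn1]
          have h1 : (1 - x) * c * k / ((1 - x) * c - d) ≤ n - 1 := by linarith
          rw [div_le_iff₀ (by linarith)] at h1
          nlinarith
      _ = (1 - x) * (n - 1 - k) / (n * (n - 1) / 2) * (c * (n * Real.log n) / 2) := by
          field_simp
      _ ≤ _ := mul_le_mul_of_nonneg_left hm (by positivity)
  calc (n : ℝ) * ((x⁻¹) ^ k * Real.exp
      (-((1 - x) * (((n - 1 : ℕ) : ℝ) - k) / Fintype.card (Edge n) *
        (⌈c * (n * Real.log n) / 2⌉₊ : ℕ))))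
      ≤ n * ((x⁻¹) ^ k * Real.exp (-(d * Real.log n))) := by gcongr
    _ = (x⁻¹) ^ k * (Real.exp (Real.log n) * Real.exp (-(d * Real.log n))) := by
        rw [Real.exp_log hn0]; ring
    _ = _ := by rw [← Real.exp_add]; ring_nf

theorem tendsto_exp_neg_natCast : Tendsto (fun n : ℕ => Real.exp (-n)) atTop (𝓝 0) :=
  Real.tendsto_exp_neg_atTop_nhds_zero.comp tendsto_natCast_atTop_atTop

theorem tendsto_exp_mul_log {d : ℝ} (hd : d < 0) :
    Tendsto (fun n : ℕ => Real.exp (d * Real.log n)) atTop (𝓝 0) :=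
  Real.tendsto_exp_atBot.comp (tendsto_log_natCast.const_mul_atTop_of_neg hd)

/-- The two-phase strategy reaches minimum degree `k` with high probability. -/
theorem exists_strategy_le_minDeg (k : ℕ) (hk : 0 < k) (ε : ℝ) (hε : 0 < ε) (t b : ℕ → ℕ)
    (ht : ∀ᶠ n : ℕ in atTop, (1 + ε) * (n : ℝ) * Real.log (n : ℝ) / 2 ≤ (t n : ℝ))
    (hb : ∀ᶠ n : ℕ in atTop, (1 + ε) * (k : ℝ) * (n : ℝ) / 2 ≤ (b n : ℝ)) :
    ∃ S : (n : ℕ) → Strategy n (t n) (b n),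
      Tendsto (fun n : ℕ => graphProb (builderLaw (S n)) {G | k ≤ minDeg G}) atTop (𝓝 1) := by
  obtain ⟨e, he0, he1, heε⟩ : ∃ e : ℝ, 0 < e ∧ e ≤ 1 ∧ e ≤ ε :=
    ⟨min ε 1, lt_min hε one_pos, min_le_right _ _, min_le_left _ _⟩
  -- The phases together take `(1 + 3e/4) n log n / 2` steps up to rounding, and the remaining `e/8
  -- · n log n` covers the two ceilings.
  set t₁ : ℕ → ℕ := fun n => ⌈e / 8 * (n * Real.log n)⌉₊ with ht₁
  set m : ℕ → ℕ := fun n => ⌈(1 + e / 2) * (n * Real.log n) / 2⌉₊ with hm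
  refine ⟨fun n => PMF.pure (twoPhaseStrategy n k (t₁ n) (t n) (b n)), ?_⟩
  simp only [builderLaw, PMF.pure_bind, graphProb_map_uniform]
  -- With `x = e/16` and `e ≤ 1`, `(1 - x)(1 + e/2) > 1 + e/8`, so the union bound over `n` vertices
  -- still tends to zero.
  have hx0 : 0 < e / 16 := by positivity
  have hη : 0 < ε / 2 := by positivity
  have hlim : Tendsto (fun n : ℕ => 1 - (Real.exp (-n) +
      ((e / 16)⁻¹) ^ k * Real.exp ((1 - (1 + e / 8)) * Real.log n))) atTop (𝓝 1) := by
    have h := (tendsto_exp_neg_natCast.add ((tendsto_exp_mul_log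
      (by linarith : 1 - (1 + e / 8) < 0)).const_mul (((e / 16)⁻¹) ^ k))).const_sub 1
    simpa using h
  refine tendsto_ofReal_orderProb hlim ?_
  filter_upwards [ht, hb, eventually_linear_set_spans k hη,
    eventually_first_phase_bound k (by positivity : 0 < e / 8)
      (by positivity : 0 < (ε / 2) ^ 2 / 4),
    eventually_second_phase_bound k (x := e / 16) (c := 1 + e / 2) (d := 1 + e / 8) hx0
      (by linarith) (by positivity) (by nlinarith),
    eventually_const_le_natCast 8, eventually_const_le_natCast (k + 1),
    eventually_const_le_natCast (2 / ε), eventually_const_le_natCast (16 / e),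
    eventually_const_le_log 1, eventually_log_le_mul (by norm_num : (0 : ℝ) < 1 / 8)]
    with n htn hbn hU h1 h2 hn8 hnk hnε hne hL1 hL
  have hn0 : (0 : ℝ) < n := by linarith
  have hnL : (n : ℝ) ≤ n * Real.log n := le_mul_of_one_le_right hn0.le hL1
  have ht₁n : (t₁ n : ℝ) < e / 8 * (n * Real.log n) + 1 := Nat.ceil_lt_add_one (by positivity)
  have hmn : (m n : ℝ) < (1 + e / 2) * (n * Real.log n) / 2 + 1 :=
    Nat.ceil_lt_add_one (by positivity)
  rw [div_le_iff₀ hε] at hnε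
  rw [div_le_iff₀ he0] at hne
  have hsum : t₁ n + m n ≤ t n := by
    have : (t₁ n : ℝ) + m n ≤ t n := by
      refine le_trans ?_ htn
      nlinarith
    exact_mod_cast this
  have hN : t₁ n + m n ≤ Fintype.card (Edge n) := by
    have : (t₁ n : ℝ) + m n ≤ Fintype.card (Edge n) := by
      rw [card_edge_real]
      have : n * Real.log n ≤ n * (1 / 8 * n) := mul_le_mul_of_nonneg_left hL hn0.le
      have h0 : e * (n * Real.log n) ≤ n * Real.log n :=
        mul_le_of_le_one_left (by positivity) he1
      nlinarith
    exact_mod_cast this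
  -- Here `ε` itself is used, not the capped `e`: allowing `εn/2` deficient vertices matches the
  -- budget `(1 + ε)kn/2`.
  have hu : 1 ≤ ⌊ε / 2 * n⌋₊ := Nat.le_floor (by push_cast; nlinarith)
  have hbud : k * n + 2 * (k * ⌊ε / 2 * n⌋₊) ≤ 2 * b n := by
    have hfl : (⌊ε / 2 * n⌋₊ : ℝ) ≤ ε / 2 * n := Nat.floor_le (by positivity)
    have : (k : ℝ) * n + 2 * (k * ⌊ε / 2 * n⌋₊) ≤ 2 * b n := by
      have := mul_le_mul_of_nonneg_left hfl (Nat.cast_nonneg k : (0 : ℝ) ≤ k)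
      nlinarith
    exact_mod_cast this
  have hkn : k ≤ n - 1 := by
    have : k + 1 ≤ n := by exact_mod_cast hnk
    omega
  have key := orderProb_twoPhase (x := e / 16) (y := (ε / 2) ^ 2 / 4)
    (by exact_mod_cast hn0) hu hk hkn hbud hsum hN hx0 (by linarith)
    (fun U h => (hU U h).1) (fun U h => (hU U h).2)
  refine le_trans (sub_le_sub_left (add_le_add h1 h2) 1) ?_
  exact key

/-! ### Optimality of the time: isolated vertices by the second moment method. -/

/-- The vertex `v` lies on none of the first `t` edges. -/
def IsolatedAt {n : ℕ} (t : ℕ) (v : Fin n) (π : EdgeOrder n) : Prop :=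
  ∀ i ∈ positions n 0 t, π i ∉ edgesAt v

theorem isolatedAt_iff {n t : ℕ} (v : Fin n) (π : EdgeOrder n) :
    IsolatedAt t v π ↔ ∀ w, ¬ (SimpleGraph.fromEdgeSet (observedEdges π t)).Adj v w := by
  constructor
  · intro h w hw
    rw [SimpleGraph.fromEdgeSet_adj] at hw
    obtain ⟨⟨i, hi, he⟩, -⟩ := hw
    refine h i (by simp [positions, hi]) ?_
    simp [edgesAt, ← he]
  · intro h i hi hv
    have hi := (Finset.mem_filter.1 hi).2.2
    obtain ⟨w, hw⟩ := (Finset.mem_filter.1 hv).2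
    refine h w ?_
    rw [SimpleGraph.fromEdgeSet_adj]
    refine ⟨⟨i, hi, hw.symm⟩, ?_⟩
    rintro rfl
    exact (π i).2 (by rw [hw]; simp)

theorem orderProb_avoid {n t : ℕ} (ht : t ≤ Fintype.card (Edge n)) (S : Finset (Edge n)) :
    orderProb n (fun π => ∀ i ∈ positions n 0 t, π i ∉ S) =
      ∏ i ∈ Finset.range t, (1 - (S.card : ℝ) / ((Fintype.card (Edge n) : ℝ) - i)) := by
  rw [orderProb_eq, div_eq_iff (card_edgeOrder_pos n).ne']
  have h := card_avoid S (positions n 0 t)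
  rw [card_positions ht, Nat.sub_zero, Fintype.card_fin] at h
  convert! h

/-- The second moment method for a finite family of events. -/
theorem second_moment_orderProb {n : ℕ} {ι : Type*} [Fintype ι] (A : ι → EdgeOrder n → Prop) :
    (∑ v, orderProb n (A v)) ^ 2 ≤
      orderProb n (fun π => ∃ v, A v π) *
        ∑ u, ∑ v, orderProb n (fun π => A u π ∧ A v π) := by
  classical
  set M : ℝ := ((Fintype.card (EdgeOrder n) : ℕ) : ℝ) with hM
  have hM0 : 0 < M := card_edgeOrder_pos n
  set X : EdgeOrder n → ℝ := fun π => ∑ v, if A v π then (1 : ℝ) else 0 with hX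
  set T := Finset.univ.filter fun π : EdgeOrder n => ∃ v, A v π with hT
  have hX0 : ∀ π ∉ T, X π = 0 := by
    intro π hπ
    refine Finset.sum_eq_zero fun v _ => if_neg fun h => hπ ?_
    simpa [hT] using ⟨v, h⟩
  have h1 : ∑ π ∈ T, X π = M * ∑ v, orderProb n (A v) := by
    rw [Finset.sum_subset (Finset.subset_univ T) fun π _ h => hX0 π h, Finset.sum_comm,
      Finset.mul_sum]
    refine Finset.sum_congr rfl fun v _ => ?_
    rw [orderProb_eq, Finset.sum_boole, ← hM, mul_div_cancel₀ _ hM0.ne']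
  have h2 : ∑ π ∈ T, X π ^ 2 = M * ∑ u, ∑ v, orderProb n (fun π => A u π ∧ A v π) := by
    rw [Finset.sum_subset (Finset.subset_univ T) fun π _ h => by rw [hX0 π h]; norm_num]
    simp_rw [hX, sq, Finset.sum_mul_sum]
    rw [Finset.sum_comm, Finset.mul_sum]
    refine Finset.sum_congr rfl fun u _ => ?_
    rw [Finset.sum_comm, Finset.mul_sum]
    refine Finset.sum_congr rfl fun v _ => ?_
    rw [orderProb_eq, ← Finset.sum_boole]
    rw [mul_div_cancel₀ _ hM0.ne']
    refine Finset.sum_congr rfl fun π _ => ?_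
    by_cases h : A u π <;> by_cases h' : A v π <;> simp [h, h']
  have h3 : (T.card : ℝ) = M * orderProb n (fun π => ∃ v, A v π) := by
    rw [orderProb_eq, ← hM, mul_div_cancel₀ _ hM0.ne']
  -- Cauchy–Schwarz on the set where the count `X` is nonzero.
  have h := sq_sum_le_card_mul_sum_sq (s := T) (f := X)
  rw [h1, h2, h3] at h
  have hM2 : 0 < M ^ 2 := by positivity
  refine le_of_mul_le_mul_left ?_ hM2
  calc _ = (M * ∑ v, orderProb n (A v)) ^ 2 := by ring
    _ ≤ _ := h
    _ = _ := by ring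

/-- The diagonal pairs give the first summand. For distinct vertices the union of their stars, with
`2(n - 1) - 1` edges, must be avoided. -/
theorem second_moment_isolated {n t : ℕ} (ht : t ≤ Fintype.card (Edge n)) :
    ((n : ℝ) * ∏ i ∈ Finset.range t, (1 - ((n - 1 : ℕ) : ℝ) / ((Fintype.card (Edge n) : ℝ) - i))) ^ 2
      ≤ orderProb n (fun π => ∃ v, IsolatedAt t v π) *
        (n * ∏ i ∈ Finset.range t, (1 - ((n - 1 : ℕ) : ℝ) / ((Fintype.card (Edge n) : ℝ) - i)) +
          n * ((n - 1 : ℕ) * ∏ i ∈ Finset.range t,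
            (1 - (2 * ((n - 1 : ℕ) : ℝ) - 1) / ((Fintype.card (Edge n) : ℝ) - i)))) := by
  have h1 : ∀ v : Fin n, orderProb n (IsolatedAt t v) =
      ∏ i ∈ Finset.range t, (1 - ((n - 1 : ℕ) : ℝ) / ((Fintype.card (Edge n) : ℝ) - i)) := by
    intro v
    rw [← card_edgesAt v]
    exact orderProb_avoid ht (edgesAt v)
  have h2 : ∀ u v : Fin n, u ≠ v →
      orderProb n (fun π => IsolatedAt t u π ∧ IsolatedAt t v π) =
      ∏ i ∈ Finset.range t,
        (1 - (2 * ((n - 1 : ℕ) : ℝ) - 1) / ((Fintype.card (Edge n) : ℝ) - i)) := by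
    intro u v huv
    have hc : ((edgesAt u ∪ edgesAt v).card : ℝ) = 2 * ((n - 1 : ℕ) : ℝ) - 1 := by
      have := card_edgesAt_union huv
      rw [eq_sub_iff_add_eq]
      exact_mod_cast this
    rw [← hc, ← orderProb_avoid ht]
    congr 1
    funext π
    refine propext ⟨fun h i hi hS => ?_, fun h => ⟨fun i hi hS => ?_, fun i hi hS => ?_⟩⟩
    · rcases Finset.mem_union.1 hS with hS | hS
      exacts [h.1 i hi hS, h.2 i hi hS]
    · exact h i hi (Finset.mem_union_left _ hS)
    · exact h i hi (Finset.mem_union_right _ hS)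
  have h := second_moment_orderProb (n := n) (fun v => IsolatedAt t v)
  simp_rw [h1] at h
  rw [Finset.sum_const, Finset.card_univ, Fintype.card_fin, nsmul_eq_mul] at h
  refine h.trans (le_of_eq ?_)
  congr 1
  rw [← mul_add]
  have h3 : ∀ u : Fin n, ∑ v, orderProb n (fun π => IsolatedAt t u π ∧ IsolatedAt t v π) =
      ∏ i ∈ Finset.range t, (1 - ((n - 1 : ℕ) : ℝ) / ((Fintype.card (Edge n) : ℝ) - i)) +
        (n - 1 : ℕ) * ∏ i ∈ Finset.range t,
            (1 - (2 * ((n - 1 : ℕ) : ℝ) - 1) / ((Fintype.card (Edge n) : ℝ) - i)) := by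
    intro u
    rw [← Finset.add_sum_erase _ _ (Finset.mem_univ u),
      Finset.sum_congr rfl fun v hv => h2 u v (Finset.ne_of_mem_erase hv).symm, Finset.sum_const,
      Finset.card_erase_of_mem (Finset.mem_univ u), Finset.card_univ, Fintype.card_fin,
      nsmul_eq_mul]
    simp only [and_self]
    rw [← h1 u]
  rw [Finset.sum_congr rfl fun u _ => h3 u, Finset.sum_const, Finset.card_univ, Fintype.card_fin,
    nsmul_eq_mul]

/-- Factor by factor, `log z ≥ 1 - 1/z` at `z = 1 - s/(N - i)` gives `-s/(N - i - s)`, which is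
smallest at the end of the range. -/
theorem exp_neg_le_prod_one_sub {N s : ℝ} {t : ℕ} (hs : 0 ≤ s) (hN : 0 < N - t - s) :
    Real.exp (-(t * s / (N - t - s))) ≤ ∏ i ∈ Finset.range t, (1 - s / (N - i)) := by
  have : Real.exp (-(t * s / (N - t - s))) =
      ∏ _i ∈ Finset.range t, Real.exp (-(s / (N - t - s))) := by
    rw [Finset.prod_const, Finset.card_range, ← Real.exp_nat_mul]
    ring_nf
  rw [this]
  refine Finset.prod_le_prod (fun _ _ => (Real.exp_pos _).le) fun i hi => ?_
  have hit : (i : ℝ) ≤ t := by exact_mod_cast (Finset.mem_range.1 hi).le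
  have h1 : 0 < N - i - s := by linarith
  have h2 : 0 < N - i := by linarith
  have h3 : 1 - s / (N - i) = (N - i - s) / (N - i) := by field_simp
  have h4 : 0 < 1 - s / (N - i) := by rw [h3]; positivity
  rw [← Real.le_log_iff_exp_le h4]
  refine le_trans ?_ (Real.one_sub_inv_le_log_of_pos h4)
  have h5 : 1 - (1 - s / (N - i))⁻¹ = -(s / (N - i - s)) := by
    rw [h3]; field_simp; ring
  rw [h5, neg_le_neg_iff]
  exact div_le_div_of_nonneg_left hs hN (by linarith)

/-- Near-independence of two stars. With `z = s/(N - i)` and `y = 1/(N - i)`, each factor satisfies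
`1 - 2z + y ≤ (1 + 4y)(1 - z)²`, because `z ≤ 1/2` gives `(1 - z)² ≥ 1/4`; and `4y ≤ 8/N` since `i ≤
N/2`. -/
theorem prod_one_sub_two_mul_le {N s : ℝ} {t : ℕ} (hs : 1 ≤ s) (hN : 2 * s + t ≤ N)
    (ht : 2 * t ≤ N) :
    ∏ i ∈ Finset.range t, (1 - (2 * s - 1) / (N - i)) ≤
      Real.exp (8 * t / N) * (∏ i ∈ Finset.range t, (1 - s / (N - i))) ^ 2 := by
  have hN0 : 0 < N := by
    have : (0 : ℝ) ≤ t := Nat.cast_nonneg t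
    linarith
  have h0 : Real.exp (8 * t / N) = ∏ _i ∈ Finset.range t, Real.exp (8 / N) := by
    rw [Finset.prod_const, Finset.card_range, ← Real.exp_nat_mul]
    ring_nf
  rw [h0, ← Finset.prod_pow, ← Finset.prod_mul_distrib]
  refine Finset.prod_le_prod (fun i hi => ?_) fun i hi => ?_ <;>
  · have hit : (i : ℝ) ≤ t := by exact_mod_cast (Finset.mem_range.1 hi).le
    have h1 : 2 * s ≤ N - i := by linarith
    have h2 : 0 < N - i := by linarith
    have hz : s / (N - i) ≤ 1 / 2 := by rw [div_le_iff₀ h2]; linarith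
    have hinv : 0 < 1 / (N - i) := by positivity
    have he : (2 * s - 1) / (N - i) = 2 * (s / (N - i)) - 1 / (N - i) := by ring
    rw [he]
    -- The first alternative proves that the factors are nonnegative, the second compares them.
    first
    | linarith
    | have hz0 : 0 ≤ s / (N - i) := by positivity
      have h3 : 1 + 4 * (1 / (N - i)) ≤ Real.exp (8 / N) := by
        refine le_trans ?_ (Real.add_one_le_exp _)
        have : 4 * (1 / (N - i)) ≤ 8 / N := by
          rw [mul_one_div, div_le_div_iff₀ h2 hN0]
          linarith
        linarith
      refine le_trans ?_ (mul_le_mul_of_nonneg_right h3 (sq_nonneg _))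
      generalize s / (N - i) = z at *
      generalize 1 / (N - i) = y at *
      have : 1 / 4 ≤ (1 - z) ^ 2 := by nlinarith
      nlinarith [sq_nonneg z]

/-- The numerator is at most `(1 - e) L N` and the denominator at least `(1 - e/2) N`; the claim is
then `1 - e ≤ (1 - e/2)²`. -/
theorem isolated_exponent_le {n e L N T : ℝ} (he1 : e ≤ 1 / 2) (hL0 : 0 ≤ L)
    (hN0 : 0 < N) (hn : 1 ≤ n) (hN : N = n * (n - 1) / 2) (hT : T ≤ (1 - e) * (n * L) / 2)
    (hsmall : T + 2 * (n - 1) ≤ e / 2 * N) :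
    T * (n - 1) / (N - T - (n - 1)) ≤ (1 - e / 2) * L := by
  have hd : (1 - e / 2) * N ≤ N - T - (n - 1) := by linarith
  have hpos : 0 < (1 - e / 2) * N := mul_pos (by linarith) hN0
  rw [div_le_iff₀ (hpos.trans_le hd)]
  have h1 : T * (n - 1) ≤ (1 - e) * L * N :=
    (mul_le_mul_of_nonneg_right hT (sub_nonneg.2 hn)).trans (le_of_eq (by rw [hN]; ring))
  have h2 : (1 - e / 2) * L * ((1 - e / 2) * N) ≤ (1 - e / 2) * L * (N - T - (n - 1)) :=
    mul_le_mul_of_nonneg_left hd (mul_nonneg (by linarith) hL0)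
  have h3 : 0 ≤ e ^ 2 / 4 * (L * N) := by positivity
  have h4 : (1 - e / 2) * L * ((1 - e / 2) * N) = (1 - e) * L * N + e ^ 2 / 4 * (L * N) := by ring
  linarith

/-- Here `a` is the mean and `q` the off-diagonal part of the second moment. The diagonal part `a`
is at most `c a²`, so the second moment is at most `(c + R) a²`. -/
theorem one_div_le_of_second_moment {a c R P q : ℝ} (ha : 0 < a) (hc : 1 / a ≤ c)
    (hq : q ≤ R * a ^ 2) (hP : 0 ≤ P) (hcR : 0 < c + R) (h : a ^ 2 ≤ P * (a + q)) :
    1 / (c + R) ≤ P := by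
  rw [div_le_iff₀ hcR]
  have h1 : a ≤ c * a ^ 2 := by
    rw [div_le_iff₀ ha] at hc
    calc a = 1 * a := (one_mul a).symm
      _ ≤ c * a * a := mul_le_mul_of_nonneg_right hc ha.le
      _ = c * a ^ 2 := by ring
  have h2 : a + q ≤ (c + R) * a ^ 2 := by linarith
  refine le_of_mul_le_mul_right ?_ (by positivity : 0 < a ^ 2)
  rw [one_mul, mul_assoc]
  exact h.trans (mul_le_mul_of_nonneg_left h2 hP)

/-- Below the connectivity threshold there is an isolated vertex with high probability. -/
theorem tendsto_graphProb_isolated (ε : ℝ) (hε : 0 < ε) (t : ℕ → ℕ)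
    (ht : ∀ᶠ n : ℕ in atTop, (t n : ℝ) ≤ (1 - ε) * (n : ℝ) * Real.log (n : ℝ) / 2) :
    Tendsto (fun n : ℕ => graphProb (processLaw n (t n)) {G | ∃ v, ∀ w, ¬ G.Adj v w})
      atTop (𝓝 1) := by
  obtain ⟨e, he0, he1, heε⟩ : ∃ e : ℝ, 0 < e ∧ e ≤ 1 / 2 ∧ e ≤ ε :=
    ⟨min ε (1 / 2), lt_min hε (by norm_num), min_le_right _ _, min_le_left _ _⟩
  have hev : ∀ n (π : EdgeOrder n), (SimpleGraph.fromEdgeSet (observedEdges π (t n)) ∈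
      {G : SimpleGraph (Fin n) | ∃ v, ∀ w, ¬ G.Adj v w}) ↔ ∃ v, IsolatedAt (t n) v π := by
    intro n π
    simp only [isolatedAt_iff]
    rfl
  simp only [processLaw, graphProb_map_uniform, hev]
  have hlog : Tendsto (fun n : ℕ => 16 * (Real.log n / n)) atTop (𝓝 0) := by
    have h := (Real.isLittleO_log_id_atTop.tendsto_div_nhds_zero.comp
      (tendsto_natCast_atTop_atTop (R := ℝ))).const_mul 16
    simpa using h
  have hlim : Tendsto (fun n : ℕ => 1 / (Real.exp (-(e / 2) * Real.log n) +
      Real.exp (16 * (Real.log n / n)))) atTop (𝓝 1) := by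
    have h := ((tendsto_exp_mul_log (by linarith : -(e / 2) < 0)).add
      ((Real.continuous_exp.tendsto 0).comp hlog)).inv₀ (by simp)
    simpa using h
  refine tendsto_ofReal_orderProb hlim ?_
  filter_upwards [ht, eventually_const_le_natCast 2, eventually_const_le_natCast (32 / e),
    eventually_const_le_log 0, eventually_log_le_mul (by positivity : 0 < e / 8)]
    with n htn hn2 hne hL0 hL
  rw [div_le_iff₀ he0] at hne
  have hn0 : (0 : ℝ) < n := by linarith
  have hs : ((n - 1 : ℕ) : ℝ) = n - 1 := by
    rw [Nat.cast_sub (by exact_mod_cast (by linarith : (1 : ℝ) ≤ n)), Nat.cast_one]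
  set L := Real.log n with hLdef
  set N : ℝ := ((Fintype.card (Edge n) : ℕ) : ℝ) with hNdef
  have hN : N = n * (n - 1) / 2 := card_edge_real n
  have hN0 : 0 < N := by
    rw [hN]
    have : (0 : ℝ) < n - 1 := by linarith
    positivity
  set T : ℝ := (t n : ℝ) with hTdef
  have hT0 : 0 ≤ T := Nat.cast_nonneg _
  have hnL : 0 ≤ n * L := by positivity
  have hT : T ≤ (1 - e) * (n * L) / 2 := by nlinarith
  have hT' : T ≤ n * L / 2 := by nlinarith
  have hsmall : T + 2 * (n - 1) ≤ e / 2 * N := by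
    have h1 : n * L ≤ n * (e / 8 * n) := mul_le_mul_of_nonneg_left hL hn0.le
    rw [hN]
    nlinarith
  have h2T : 2 * T ≤ N := by nlinarith
  have htN : t n ≤ Fintype.card (Edge n) := by
    have : T ≤ N := by linarith
    exact Nat.cast_le.1 this
  have hmom := second_moment_isolated htN
  rw [hs] at hmom
  have hp1 := exp_neg_le_prod_one_sub (N := N) (s := n - 1) (t := t n) (by linarith)
    (by nlinarith)
  have hp2 := prod_one_sub_two_mul_le (N := N) (s := n - 1) (t := t n) (by linarith)
    (by nlinarith) h2T
  set p₁ := ∏ i ∈ Finset.range (t n), (1 - ((n : ℝ) - 1) / (N - i))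
  set p₂ := ∏ i ∈ Finset.range (t n), (1 - (2 * ((n : ℝ) - 1) - 1) / (N - i))
  set P := orderProb n (fun π => ∃ v, IsolatedAt (t n) v π)
  have hP0 : 0 ≤ P := by
    simp only [P, orderProb]
    positivity
  -- The expected number of isolated vertices is at least `n ^ (e/2)`.
  have ha : Real.exp (e / 2 * L) ≤ n * p₁ := by
    calc Real.exp (e / 2 * L) ≤ Real.exp (L + -(T * (n - 1) / (N - T - (n - 1)))) := by
          refine Real.exp_le_exp.2 ?_
          have := isolated_exponent_le he1 hL0 hN0 (by linarith) hN hT hsmall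
          linarith
      _ = n * Real.exp (-(T * (n - 1) / (N - T - (n - 1)))) := by
          rw [Real.exp_add, Real.exp_log hn0]
      _ ≤ n * p₁ := mul_le_mul_of_nonneg_left hp1 hn0.le
  -- The correlation factor tends to one because `T` is at most `nL/2` and `N` is quadratic in `n`.
  have hR : Real.exp (8 * T / N) ≤ Real.exp (16 * (L / n)) := by
    refine Real.exp_le_exp.2 ?_
    have h1 : (0 : ℝ) < n - 1 := by linarith
    have h2 : T * n ≤ L * (n * (n - 1)) := by
      have h3 : T * n ≤ n * L / 2 * n := mul_le_mul_of_nonneg_right hT' hn0.le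
      have h4 : 0 ≤ n * L * (n - 2) := mul_nonneg hnL (by linarith)
      linarith
    rw [mul_div_assoc', div_le_div_iff₀ hN0 hn0, hN]
    linarith
  have ha0 : 0 < n * p₁ := (Real.exp_pos _).trans_le ha
  have hinv : 1 / (n * p₁) ≤ Real.exp (-(e / 2) * L) := by
    rw [neg_mul, Real.exp_neg, ← one_div]
    exact one_div_le_one_div_of_le (Real.exp_pos _) ha
  have hq : (n : ℝ) * ((n - 1) * p₂) ≤ Real.exp (16 * (L / n)) * (n * p₁) ^ 2 := by
    have h1 : p₂ ≤ Real.exp (16 * (L / n)) * p₁ ^ 2 :=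
      hp2.trans (mul_le_mul_of_nonneg_right hR (sq_nonneg _))
    have h2 : 0 ≤ Real.exp (16 * (L / n)) * p₁ ^ 2 := by positivity
    have h3 : (n - 1) * p₂ ≤ n * (Real.exp (16 * (L / n)) * p₁ ^ 2) := by nlinarith
    calc (n : ℝ) * ((n - 1) * p₂) ≤ n * (n * (Real.exp (16 * (L / n)) * p₁ ^ 2)) :=
          mul_le_mul_of_nonneg_left h3 hn0.le
      _ = _ := by ring
  exact one_div_le_of_second_moment ha0 hinv hq hP0 (by positivity) hmom

theorem mainTheorem2 (k : ℕ) (hk : 0 < k) (ε : ℝ) (hε : 0 < ε) :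
    (∀ t b : ℕ → ℕ,
      (∀ᶠ n : ℕ in atTop, (1 + ε) * (n : ℝ) * Real.log (n : ℝ) / 2 ≤ (t n : ℝ)) →
      (∀ᶠ n : ℕ in atTop, (1 + ε) * (k : ℝ) * (n : ℝ) / 2 ≤ (b n : ℝ)) →
      ∃ S : (n : ℕ) → Strategy n (t n) (b n),
        Tendsto (fun n : ℕ => graphProb (builderLaw (S n)) {G | k ≤ minDeg G}) atTop (𝓝 1)) ∧
    (∀ n t b : ℕ, (b : ℝ) < (k : ℝ) * (n : ℝ) / 2 →
      ∀ S : Strategy n t b, graphProb (builderLaw S) {G | k ≤ minDeg G} = 0) ∧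
    (∀ t : ℕ → ℕ,
      (∀ᶠ n : ℕ in atTop, (t n : ℝ) ≤ (1 - ε) * (n : ℝ) * Real.log (n : ℝ) / 2) →
      Tendsto (fun n : ℕ => graphProb (processLaw n (t n)) {G | ∃ v, ∀ w, ¬ G.Adj v w})
        atTop (𝓝 1)) :=
  ⟨fun t b ht hb => exists_strategy_le_minDeg k hk ε hε t b ht hb,
    fun _ _ _ hb S => graphProb_le_minDeg_eq_zero hb S,
    fun t ht => tendsto_graphProb_isolated ε hε t ht⟩
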